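/- Let $\alpha\in(1,2]$, $\beta=\frac{\alpha}{\alpha-1}$, $\varphi(x)=\frac{|x|^\alpha}{\alpha}$. A random variable $\zeta$ is $\varphi$-sub-Gaussian if $\mathbf{E}\zeta=0$, $\mathbf{E}e^{\lambda\zeta}<\infty$ for all $\lambda\in\mathbb{R}$, and for some $a>0$ one has $\mathbf{E}e^{\lambda\zeta}\le e^{\varphi(a\lambda)}$ for all $\lambda\in\mathbb{R}$; $\tau_\varphi(\zeta)$ denotes the infimum of all such $a>0$. Let $T=[a_1,b_1]\times[a_2,b_2]$, $T_i=b_i-a_i\ge 0$, with the metric $d(t,s)=|t_1-s_1|^{H_1}+|t_2-s_2|^{H_2}$, where $H_1,H_2\in(0,1]$. Let $X(t)$, $t\in T$, be a random field such that every $X(t)$ is $\varphi$-sub-Gaussian and $X$ is separable on $(T,d)$, i.e. there are a countable dense $S\subseteq T$ and a null event off which, for every open $U\subseteq T$ and closed $F\subseteq\mathbb{R}$, $X(s)\in F$ for all $s\in S\cap U$ implies $X(t)\in F$ for all $t\in U$. Suppose that $\varepsilon_0:=\sup_{t\in T}\tau_\varphi(X(t))<\infty$ and that for some $c>0$ and $\gamma\in(0,1]$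 with $\gamma\beta>1$ $$\sup_{t,s\in T,\ d(t,s)\le h}\tau_\varphi(X(t)-X(s))\le c\,h^\gamma,\qquad 0<h\le \sup_{t,s\in T}d(t,s).$$ Put $\gamma_0=c\,\bigl(\sup_{t,s\in T}d(t,s)\bigr)^\gamma$ and $$c_1=\frac{2^{1/\beta}c^{1/(\gamma\beta)}}{1-\frac1{\gamma\beta}}\sum_{i=1}^{2}\frac1{H_i}\Bigl(\frac{T_i}{2}\Bigr)^{H_i/\beta}.$$ Then for all $\lambda>0$ and $\theta\in(0,1)$ $$\mathbf{E}\exp\Bigl\{\lambda\sup_{t\in T}|X(t)|\Bigr\}\le 2\exp\Bigl\{\frac1\alpha\Bigl(\frac{\lambda\varepsilon_0}{1-\theta}\Bigr)^\alpha+\frac{2\lambda}{\theta(1-\theta)}(\theta\varepsilon_0)^{1-\frac1{\gamma\beta}}c_1\Bigr\},$$ and for all $\theta\in(0,1)$ with $\theta\varepsilon_0<\gamma_0$ and all $u>\frac{2}{\theta(1-\theta)}(\theta\varepsilon_0)^{1-\frac1{\gamma\beta}}c_1$ $$\mathbf{P}\Bigl\{\sup_{t\in T}|X(t)|>u\Bigr\}\le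 2\exp\Bigl\{-\frac1\beta\Bigl(\frac1{\varepsilon_0}\Bigl(u(1-\theta)-\frac2\theta(\theta\varepsilon_0)^{1-\frac1{\gamma\beta}}c_1\Bigr)\Bigr)^\beta\Bigr\}$$ (if $\varepsilon_0=0$, the left-hand side of the last inequality is $0$). -/

import Mathlib

open MeasureTheory

noncomputable section

/-- The Orlicz N-function `φ(x) = |x|^α / α`. -/
def powerPhi (α : ℝ) (x : ℝ) : ℝ := |x| ^ α / α

/-- `ζ` belongs to the space `Sub_φ(Ω)` of `φ`-sub-Gaussian random variables. -/
structure IsPhiSubGaussian {Ω : Type*} [MeasurableSpace Ω] (P : Measure Ω) (φ : ℝ → ℝ)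
    (ζ : Ω → ℝ) : Prop where
  aemeasurable : AEMeasurable ζ P
  integrable : Integrable ζ P
  mean_zero : ∫ ω, ζ ω ∂P = 0
  integrable_exp : ∀ l : ℝ, Integrable (fun ω => Real.exp (l * ζ ω)) P
  exists_bound : ∃ a : ℝ, 0 < a ∧
    ∀ l : ℝ, ∫ ω, Real.exp (l * ζ ω) ∂P ≤ Real.exp (φ (l * a))

/-- The norm `τ_φ(ζ) = inf {a > 0 : E exp(λ ζ) ≤ exp(φ(a λ)) for all λ ∈ ℝ}` of `Sub_φ(Ω)`. -/
def tauPhi {Ω : Type*} [MeasurableSpace Ω] (P : Measure Ω) (φ : ℝ → ℝ) (ζ : Ω → ℝ) : ℝ :=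
  sInf {a : ℝ | 0 < a ∧ ∀ l : ℝ, ∫ ω, Real.exp (l * ζ ω) ∂P ≤ Real.exp (φ (a * l))}

/-- The anisotropic metric `d(t, s) = |t₁ - s₁|^{H₁} + |t₂ - s₂|^{H₂}`. -/
def anisoDist (H : Fin 2 → ℝ) (t s : Fin 2 → ℝ) : ℝ := ∑ i, |t i - s i| ^ H i

/-- `U` is open in the metric space `(T, d)`. -/
def IsOpenFor {T : Type*} (d : T → T → ℝ) (U : Set T) : Prop :=
  ∀ t ∈ U, ∃ r : ℝ, 0 < r ∧ ∀ s : T, d t s < r → s ∈ U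

/-- `S` is dense in the metric space `(T, d)`. -/
def IsDenseFor {T : Type*} (d : T → T → ℝ) (S : Set T) : Prop :=
  ∀ t : T, ∀ r : ℝ, 0 < r → ∃ s ∈ S, d t s < r

/-- The process `X` is separable on `(T, d)` (Doob): there are a countable dense `S ⊆ T` and a null
event off which, for all open `U ⊆ T` and closed `F ⊆ ℝ`, if `X(s) ∈ F` for all `s ∈ S ∩ U` then
`X(t) ∈ F` for all `t ∈ U`. -/
def IsSeparableProcess {Ω : Type*} [MeasurableSpace Ω] (P : Measure Ω) {T : Type*}
    (d : T → T → ℝ) (X : T → Ω → ℝ) : Prop :=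
  ∃ S : Set T, S.Countable ∧ IsDenseFor d S ∧
    ∀ᵐ ω ∂P, ∀ U : Set T, IsOpenFor d U → ∀ F : Set ℝ, IsClosed F →
      (∀ s ∈ S ∩ U, X s ω ∈ F) → ∀ t ∈ U, X t ω ∈ F

/-- `sup_{t ∈ T} |X(t)|`, with values in the extended reals. -/
def supAbs {Ω T : Type*} (X : T → Ω → ℝ) (ω : Ω) : EReal := ⨆ t : T, ((|X t ω| : ℝ) : EReal)

/-- The `d`-diameter `sup_{t, s ∈ T} d(t, s)` of the rectangle `T = [a₁, b₁] × [a₂, b₂]`. -/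
def rectDiam (a b H : Fin 2 → ℝ) : ℝ :=
  ⨆ p : Set.Icc a b × Set.Icc a b, anisoDist H p.1 p.2

/-- `c₁ = 2^{1/β} c^{1/(γβ)} / (1 - 1/(γβ)) · ∑ᵢ (1/Hᵢ) ((bᵢ - aᵢ)/2)^{Hᵢ/β}`. -/
def cOne (a b H : Fin 2 → ℝ) (β γ c : ℝ) : ℝ :=
  (2 : ℝ) ^ (1 / β) * c ^ (1 / (γ * β)) / (1 - 1 / (γ * β)) *
    ∑ i, 1 / H i * ((b i - a i) / 2) ^ (H i / β)

end

open Filter Topology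

/-! The proof is chaining with Hölder weights adapted to `λ`. Put `e_k = ε₀ θ^k` and let `S_k` be a
finite net of `T` at `τ`-scale `e_{k+1}`. Linking each point of `S_n` to approximating points of the
coarser nets writes `X(t)` as an initial value plus increments, the level-`k` link having norm at
most `e_k`. Bounding each link by an exponential sum over its level and applying Hölder with
exponents `p_k`, `∑ p_k ≤ 1`, leaves a product of moments (`lintegral_prod_chainSum_le`).

If the log-cardinality of `S_k` is at most `d_k^β`, the choice `p_k = λ e_k / (M^α + α d_k^β)^{1/α}`
with `M = λ ε₀ / (1 - θ)` makes level `k` contribute `p_k (log 2 + M^α/α)` plus an excess `2 p_k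
d_k^β ≤ 2 λ e_k d_k`, which is linear in `λ`. Grids give `d_k` proportional to `e_{k+1}^{-1/(γβ)}`
(`exists_increment_net`), and `γβ > 1` makes `∑ e_k d_k` converge (`sum_geometric_entropy_le`).

Almost sure convergence along the nets and separability carry the bound to the supremum
(`lintegral_exp_supAbs_le`); the tail bound is the optimised Chernoff inequality. -/

theorem powerPhi_eq_of_nonneg {α x : ℝ} (hx : 0 ≤ x) : powerPhi α x = x ^ α / α := by
  rw [powerPhi, abs_of_nonneg hx]

theorem powerPhi_le_of_abs_le {α x y : ℝ} (hα : 0 < α) (h : |x| ≤ |y|) :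
    powerPhi α x ≤ powerPhi α y := by
  unfold powerPhi
  have := Real.rpow_le_rpow (abs_nonneg x) h hα.le
  gcongr

theorem continuous_powerPhi {α : ℝ} (hα : 0 < α) : Continuous (powerPhi α) := by
  unfold powerPhi
  exact (continuous_abs.rpow_const fun _ => Or.inr hα.le).div_const _

/-! ### Moments of `φ`-sub-Gaussian variables -/

section SubGaussian

variable {Ω : Type*} [MeasurableSpace Ω] {P : Measure Ω} {α : ℝ} {ζ ξ : Ω → ℝ}

theorem tauPhi_nonneg (φ : ℝ → ℝ) : 0 ≤ tauPhi P φ ζ :=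
  Real.sInf_nonneg fun _ h => h.1.le

/-- The infimum defining `tauPhi` is attained. -/
theorem IsPhiSubGaussian.integral_exp_le (hα : 0 < α) (hζ : IsPhiSubGaussian P (powerPhi α) ζ)
    {e : ℝ} (he : tauPhi P (powerPhi α) ζ ≤ e) (l : ℝ) :
    ∫ ω, Real.exp (l * ζ ω) ∂P ≤ Real.exp (powerPhi α (e * l)) := by
  have key : ∀ a, e < a → ∫ ω, Real.exp (l * ζ ω) ∂P ≤ Real.exp (powerPhi α (a * l)) := by
    intro a ha
    obtain ⟨a₀, h0, hb⟩ := hζ.exists_bound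
    -- Nonemptiness rules out the default value `sInf ∅ = 0`.
    have hne : {a : ℝ | 0 < a ∧ ∀ l : ℝ, ∫ ω, Real.exp (l * ζ ω) ∂P ≤
        Real.exp (powerPhi α (a * l))}.Nonempty := ⟨a₀, h0, fun l => by rw [mul_comm]; exact hb l⟩
    obtain ⟨x, ⟨hx0, hx⟩, hxa⟩ := exists_lt_of_csInf_lt hne (he.trans_lt ha)
    refine (hx l).trans (Real.exp_le_exp.2 (powerPhi_le_of_abs_le hα ?_))
    rw [abs_mul, abs_mul, abs_of_pos hx0, abs_of_pos (hx0.trans hxa)]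
    gcongr
  have hc : Tendsto (fun a => Real.exp (powerPhi α (a * l))) (𝓝[>] e)
      (𝓝 (Real.exp (powerPhi α (e * l)))) :=
    ((Real.continuous_exp.comp ((continuous_powerPhi hα).comp
      (continuous_id.mul continuous_const))).tendsto e).mono_left nhdsWithin_le_nhds
  exact ge_of_tendsto hc (eventually_mem_nhdsWithin.mono fun a ha => key a ha)

/-- Since `exp (l|x|) ≤ exp (lx) + exp (-lx)`, both signs are covered; this is the origin of the
factor 2 in the final bounds. -/
theorem IsPhiSubGaussian.lintegral_exp_abs_le (hα : 0 < α)
    (hζ : IsPhiSubGaussian P (powerPhi α) ζ) {e : ℝ} (he : tauPhi P (powerPhi α) ζ ≤ e)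
    {l : ℝ} (hl : 0 ≤ l) :
    ∫⁻ ω, ENNReal.ofReal (Real.exp (l * |ζ ω|)) ∂P ≤
      ENNReal.ofReal (2 * Real.exp ((l * e) ^ α / α)) := by
  have he0 : 0 ≤ e := (tauPhi_nonneg _).trans he
  have hi := (hζ.integrable_exp l).add (hζ.integrable_exp (-l))
  calc ∫⁻ ω, ENNReal.ofReal (Real.exp (l * |ζ ω|)) ∂P
      ≤ ∫⁻ ω, ENNReal.ofReal (Real.exp (l * ζ ω) + Real.exp (-l * ζ ω)) ∂P := by
        refine lintegral_mono fun ω => ENNReal.ofReal_le_ofReal ?_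
        rcases abs_cases (ζ ω) with ⟨h, -⟩ | ⟨h, -⟩ <;> rw [h]
        · linarith [Real.exp_pos (-l * ζ ω)]
        · rw [mul_neg, ← neg_mul]
          linarith [Real.exp_pos (l * ζ ω)]
    _ = ENNReal.ofReal (∫ ω, (Real.exp (l * ζ ω) + Real.exp (-l * ζ ω)) ∂P) :=
        (ofReal_integral_eq_lintegral_ofReal hi (ae_of_all _ fun ω =>
          (add_pos (Real.exp_pos _) (Real.exp_pos _)).le)).symm
    _ ≤ _ := by
        refine ENNReal.ofReal_le_ofReal ?_
        rw [integral_add (hζ.integrable_exp l) (hζ.integrable_exp (-l))]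
        have h1 := hζ.integral_exp_le hα he l
        have h2 := hζ.integral_exp_le hα he (-l)
        have h3 : powerPhi α (e * l) = (l * e) ^ α / α := by
          rw [mul_comm, powerPhi_eq_of_nonneg (by positivity)]
        have h4 : powerPhi α (e * -l) = (l * e) ^ α / α := by
          rw [← h3, powerPhi, powerPhi, mul_neg, abs_neg]
        rw [h3] at h1
        rw [h4] at h2
        linarith

/-- Follows from `x ≤ exp x` at scale `e`. Linearity in `e` is what matters: it handles norm zero
and makes errors along the nets summable. -/
theorem IsPhiSubGaussian.lintegral_abs_le (hα : 0 < α)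
    (hζ : IsPhiSubGaussian P (powerPhi α) ζ) {e : ℝ} (he : tauPhi P (powerPhi α) ζ ≤ e)
    (he0 : 0 < e) :
    ∫⁻ ω, ENNReal.ofReal |ζ ω| ∂P ≤ ENNReal.ofReal (e * (2 * Real.exp (1 / α))) := by
  have h := hζ.lintegral_exp_abs_le hα he (inv_pos.2 he0).le
  rw [inv_mul_cancel₀ he0.ne', Real.one_rpow] at h
  calc ∫⁻ ω, ENNReal.ofReal |ζ ω| ∂P
      ≤ ∫⁻ ω, ENNReal.ofReal e * ENNReal.ofReal (Real.exp (e⁻¹ * |ζ ω|)) ∂P := by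
        refine lintegral_mono fun ω => ?_
        rw [← ENNReal.ofReal_mul he0.le]
        refine ENNReal.ofReal_le_ofReal ?_
        calc |ζ ω| = e * (e⁻¹ * |ζ ω|) := by field_simp
          _ ≤ e * Real.exp (e⁻¹ * |ζ ω|) := by
            gcongr
            linarith [Real.add_one_le_exp (e⁻¹ * |ζ ω|)]
    _ = ENNReal.ofReal e * ∫⁻ ω, ENNReal.ofReal (Real.exp (e⁻¹ * |ζ ω|)) ∂P :=
        lintegral_const_mul' _ _ ENNReal.ofReal_ne_top
    _ ≤ ENNReal.ofReal e * ENNReal.ofReal (2 * Real.exp (1 / α)) := by gcongr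
    _ = _ := (ENNReal.ofReal_mul he0.le).symm

theorem IsPhiSubGaussian.ae_eq_zero (hα : 0 < α) (hζ : IsPhiSubGaussian P (powerPhi α) ζ)
    (h0 : tauPhi P (powerPhi α) ζ ≤ 0) : ∀ᵐ ω ∂P, ζ ω = 0 := by
  have hz : ∫⁻ ω, ENNReal.ofReal |ζ ω| ∂P = 0 := by
    have hc : Tendsto (fun e : ℝ => ENNReal.ofReal (e * (2 * Real.exp (1 / α)))) (𝓝[>] 0)
        (𝓝 (ENNReal.ofReal (0 * (2 * Real.exp (1 / α))))) :=
      ((ENNReal.continuous_ofReal.comp (continuous_id.mul continuous_const)).tendsto 0).mono_left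
        nhdsWithin_le_nhds
    rw [zero_mul, ENNReal.ofReal_zero] at hc
    exact le_antisymm (ge_of_tendsto hc (eventually_mem_nhdsWithin.mono fun e he =>
      hζ.lintegral_abs_le hα (h0.trans (le_of_lt he)) he)) bot_le
  rw [lintegral_eq_zero_iff' hζ.aemeasurable.abs.ennreal_ofReal] at hz
  filter_upwards [hz] with ω hω
  exact abs_nonpos_iff.1 (ENNReal.ofReal_eq_zero.1 hω)

/-- Only membership is needed, so the crude AM-GM split of the exponential suffices and independence
plays no role. -/
theorem IsPhiSubGaussian.sub (hα : 0 < α) (hζ : IsPhiSubGaussian P (powerPhi α) ζ)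
    (hξ : IsPhiSubGaussian P (powerPhi α) ξ) :
    IsPhiSubGaussian P (powerPhi α) (fun ω => ζ ω - ξ ω) := by
  have hle : ∀ l ω, Real.exp (l * (ζ ω - ξ ω)) ≤
      (Real.exp (2 * l * ζ ω) + Real.exp (-2 * l * ξ ω)) / 2 := by
    intro l ω
    have h1 : Real.exp (2 * l * ζ ω) = Real.exp (l * ζ ω) ^ 2 := by
      rw [← Real.exp_nat_mul]; congr 1; push_cast; ring
    have h2 : Real.exp (-2 * l * ξ ω) = Real.exp (-l * ξ ω) ^ 2 := by
      rw [← Real.exp_nat_mul]; congr 1; push_cast; ring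
    have h3 : Real.exp (l * (ζ ω - ξ ω)) = Real.exp (l * ζ ω) * Real.exp (-l * ξ ω) := by
      rw [← Real.exp_add]; congr 1; ring
    rw [h1, h2, h3]
    nlinarith [sq_nonneg (Real.exp (l * ζ ω) - Real.exp (-l * ξ ω))]
  have hi : ∀ l, Integrable
      (fun ω => (Real.exp (2 * l * ζ ω) + Real.exp (-2 * l * ξ ω)) / 2) P := fun l =>
    ((hζ.integrable_exp (2 * l)).add (hξ.integrable_exp (-2 * l))).div_const 2
  have hint : ∀ l, Integrable (fun ω => Real.exp (l * (ζ ω - ξ ω))) P := fun l => by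
    refine (hi l).mono' ((Real.measurable_exp.comp_aemeasurable
      ((hζ.aemeasurable.sub hξ.aemeasurable).const_mul l)).aestronglyMeasurable)
      (ae_of_all _ fun ω => ?_)
    rw [Real.norm_eq_abs, abs_of_pos (Real.exp_pos _)]
    exact hle l ω
  obtain ⟨x, hx0, hx⟩ := hζ.exists_bound
  obtain ⟨y, hy0, hy⟩ := hξ.exists_bound
  refine ⟨hζ.aemeasurable.sub hξ.aemeasurable, hζ.integrable.sub hξ.integrable, ?_, hint,
    2 * max x y, by positivity, fun l => ?_⟩
  · rw [integral_sub hζ.integrable hξ.integrable, hζ.mean_zero, hξ.mean_zero, sub_zero]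
  · have h1 : Real.exp (powerPhi α (2 * l * x)) ≤ Real.exp (powerPhi α (l * (2 * max x y))) := by
      refine Real.exp_le_exp.2 (powerPhi_le_of_abs_le hα ?_)
      rw [show l * (2 * max x y) = 2 * l * max x y by ring, abs_mul, abs_mul (2 * l)]
      gcongr
      exact le_max_left _ _
    have h2 : Real.exp (powerPhi α (-2 * l * y)) ≤
        Real.exp (powerPhi α (l * (2 * max x y))) := by
      refine Real.exp_le_exp.2 (powerPhi_le_of_abs_le hα ?_)
      rw [show -2 * l * y = -(2 * l * y) by ring, abs_neg,
        show l * (2 * max x y) = 2 * l * max x y by ring, abs_mul, abs_mul (2 * l)]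
      gcongr
      exact le_max_right _ _
    calc _ ≤ ∫ ω, (Real.exp (2 * l * ζ ω) + Real.exp (-2 * l * ξ ω)) / 2 ∂P :=
          integral_mono (hint l) (hi l) (hle l)
      _ = (∫ ω, Real.exp (2 * l * ζ ω) ∂P + ∫ ω, Real.exp (-2 * l * ξ ω) ∂P) / 2 := by
          rw [integral_div, integral_add (hζ.integrable_exp _) (hξ.integrable_exp _)]
      _ ≤ _ := by linarith [hx (2 * l), hy (-2 * l)]

end SubGaussian

/-! ### Metric entropy of the rectangle -/

theorem Real.log_one_add_le_rpow_div {x p : ℝ} (hx : 0 ≤ x) (hp : 0 < p) (hp1 : p ≤ 1) :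
    Real.log (1 + x) ≤ x ^ p / p := by
  have h1 : (1 + x) ^ p ≤ 1 + x ^ p := by
    simpa using Real.rpow_add_le_add_rpow zero_le_one hx hp.le hp1
  rw [le_div_iff₀ hp, mul_comm, ← Real.log_rpow (by positivity)]
  have h2 := Real.log_le_sub_one_of_pos (x := (1 + x) ^ p) (by positivity)
  linarith

/-- An interval of length at most `2wx` has a `w`-net with at most `1 + x` points. -/
theorem exists_finset_Icc_net {a b w x : ℝ} (hab : a ≤ b) (hw : 0 < w) (hx : 0 ≤ x)
    (hbx : b - a ≤ 2 * w * x) :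
    ∃ s : Finset ℝ, (s.card : ℝ) ≤ 1 + x ∧ (∀ y ∈ s, y ∈ Set.Icc a b) ∧
      ∀ t ∈ Set.Icc a b, ∃ y ∈ s, |t - y| ≤ w := by
  -- The net consists of the midpoints of `n` equal cells of half-length `δ`. The `+ 1` forces `x <
  -- n`, hence `δ ≤ w`, and still `n ≤ 1 + x`.
  set n : ℕ := ⌊x⌋₊ + 1 with hn
  have hn0 : (0 : ℝ) < n := by positivity
  have hnx : x < n := by rw [hn]; push_cast; exact Nat.lt_floor_add_one x
  set δ : ℝ := (b - a) / (2 * n) with hδ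
  have hδ0 : 0 ≤ δ := by have := sub_nonneg.2 hab; positivity
  have hδn : 2 * n * δ = b - a := by rw [hδ]; field_simp
  have hδw : δ ≤ w := by
    rw [hδ, div_le_iff₀ (by positivity)]
    nlinarith
  refine ⟨(Finset.range n).image fun k : ℕ => a + (2 * k + 1) * δ, ?_, ?_, ?_⟩
  · refine (Nat.cast_le.2 Finset.card_image_le).trans ?_
    rw [Finset.card_range, hn]
    push_cast
    linarith [Nat.floor_le hx]
  · intro y hy
    obtain ⟨k, hk, rfl⟩ := Finset.mem_image.1 hy
    have hk' : (k : ℝ) + 1 ≤ n := by exact_mod_cast Finset.mem_range.1 hk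
    constructor
    · have : 0 ≤ (2 * (k : ℝ) + 1) * δ := by positivity
      linarith
    · nlinarith
  · rintro t ⟨hta, htb⟩
    rcases hδ0.eq_or_lt with h0 | h0
    · refine ⟨a + (2 * (0 : ℕ) + 1) * δ, Finset.mem_image.2 ⟨0, by simp [hn], rfl⟩, ?_⟩
      rw [← h0] at hδn ⊢
      have : t = a := by linarith
      simp [this, hw.le]
    · set r : ℝ := (t - a) / (2 * δ) with hr
      have hr0 : 0 ≤ r := by have := sub_nonneg.2 hta; positivity
      have htr : t = a + 2 * δ * r := by rw [hr]; field_simp; ring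
      have hrn : r ≤ n := by
        rw [hr, div_le_iff₀ (by positivity)]; linarith
      rcases hrn.lt_or_eq with hlt | heq
      · refine ⟨_, Finset.mem_image.2 ⟨⌊r⌋₊, Finset.mem_range.2 ((Nat.floor_lt hr0).2 hlt), rfl⟩, ?_⟩
        have h1 := Nat.floor_le hr0
        have h2 := Nat.lt_floor_add_one r
        rw [abs_le, htr]
        constructor <;> nlinarith
      -- The right endpoint has cell index `n`, out of range; it belongs to the last cell, whose
      -- index is `⌊x⌋₊`.
      · refine ⟨_, Finset.mem_image.2 ⟨⌊x⌋₊, by simp [hn], rfl⟩, ?_⟩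
        have : (n : ℝ) = ⌊x⌋₊ + 1 := by rw [hn]; push_cast; ring
        rw [abs_le, htr, heq, this]
        constructor <;> nlinarith

theorem anisoDist_le_rectDiam {a b H : Fin 2 → ℝ} (hH : ∀ i, 0 < H i) (t s : Set.Icc a b) :
    anisoDist H t s ≤ rectDiam a b H := by
  refine le_ciSup (f := fun p : Set.Icc a b × Set.Icc a b => anisoDist H p.1 p.2) ?_ (t, s)
  refine ⟨∑ i, (b i - a i) ^ H i, ?_⟩
  rintro _ ⟨⟨x, y⟩, rfl⟩
  refine Finset.sum_le_sum fun i _ => Real.rpow_le_rpow (abs_nonneg _) ?_ (hH i).le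
  have h1 := x.2.1 i
  have h2 := x.2.2 i
  have h3 := y.2.1 i
  have h4 := y.2.2 i
  rw [abs_le]
  constructor <;> linarith

theorem anisoDist_nonneg (H t s : Fin 2 → ℝ) : 0 ≤ anisoDist H t s :=
  Finset.sum_nonneg fun _ _ => Real.rpow_nonneg (abs_nonneg _) _

theorem eq_of_anisoDist_nonpos {H t s : Fin 2 → ℝ} (hH : ∀ i, 0 < H i)
    (h : anisoDist H t s ≤ 0) : t = s := by
  have h0 := le_antisymm h (anisoDist_nonneg H t s)
  funext i
  have hi := (Finset.sum_eq_zero_iff_of_nonneg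
    fun i _ => Real.rpow_nonneg (abs_nonneg (t i - s i)) (H i)).1 h0 i (Finset.mem_univ i)
  rw [Real.rpow_eq_zero (abs_nonneg _) (hH i).ne', abs_eq_zero] at hi
  linarith

/-- A grid that is an `h`-net of the rectangle for `anisoDist`, with its metric entropy. -/
theorem exists_rect_net {a b H : Fin 2 → ℝ} (hab : ∀ i, a i ≤ b i)
    (hH : ∀ i, 0 < H i ∧ H i ≤ 1) {β h : ℝ} (hβ : 1 ≤ β) (hh : 0 < h) :
    ∃ S : Finset (Set.Icc a b),
      (S.card : ℝ) ≤ Real.exp (((2 / h) ^ (1 / β) *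
        ∑ i, 1 / H i * ((b i - a i) / 2) ^ (H i / β)) ^ β) ∧
      ∀ t : Set.Icc a b, ∃ s ∈ S, anisoDist H t s ≤ h := by
  classical
  -- Each coordinate is given half of the budget `h`: `w i ^ H i = h / 2`.
  set w : Fin 2 → ℝ := fun i => (h / 2) ^ (1 / H i) with hw
  have hw0 : ∀ i, 0 < w i := fun i => by positivity
  have hT : ∀ i, 0 ≤ (b i - a i) / 2 := fun i => by linarith [hab i]
  set x : Fin 2 → ℝ := fun i => (b i - a i) / 2 / w i with hx
  have hx0 : ∀ i, 0 ≤ x i := fun i => div_nonneg (hT i) (hw0 i).le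
  have hnet : ∀ i, ∃ s : Finset ℝ, (s.card : ℝ) ≤ 1 + x i ∧ (∀ y ∈ s, y ∈ Set.Icc (a i) (b i)) ∧
      ∀ t ∈ Set.Icc (a i) (b i), ∃ y ∈ s, |t - y| ≤ w i := fun i =>
    exists_finset_Icc_net (hab i) (hw0 i) (hx0 i) (by
      have := (hw0 i).ne'
      simp only [hx]; field_simp; exact le_rfl)
  choose s hs1 hs2 hs3 using hnet
  have hmem : ∀ f ∈ Fintype.piFinset s, f ∈ Set.Icc a b := fun f hf =>
    ⟨fun i => (hs2 i _ (Fintype.mem_piFinset.1 hf i)).1,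
      fun i => (hs2 i _ (Fintype.mem_piFinset.1 hf i)).2⟩
  refine ⟨(Fintype.piFinset s).subtype (· ∈ Set.Icc a b), ?_, ?_⟩
  · rw [Finset.card_subtype, Finset.filter_true_of_mem hmem, Fintype.card_piFinset]
    set z : Fin 2 → ℝ := fun i => (2 / h) ^ (1 / β) * ((b i - a i) / 2) ^ (H i / β) with hz
    have hβ0 : 0 < β := by linarith
    have hz0 : ∀ i, 0 ≤ z i := fun i =>
      mul_nonneg (by positivity) (Real.rpow_nonneg (hT i) _)
    have hxz : ∀ i, x i ^ H i = z i ^ β := fun i => by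
      have hHi := (hH i).1
      have e1 : w i ^ H i = h / 2 := by
        simp only [hw]
        rw [← Real.rpow_mul (by positivity), one_div_mul_cancel hHi.ne', Real.rpow_one]
      have e2 : z i ^ β = (2 / h) * ((b i - a i) / 2) ^ H i := by
        simp only [hz]
        rw [Real.mul_rpow (by positivity) (Real.rpow_nonneg (hT i) _),
          ← Real.rpow_mul (by positivity), ← Real.rpow_mul (hT i),
          one_div_mul_cancel hβ0.ne', div_mul_cancel₀ _ hβ0.ne', Real.rpow_one]
      rw [e2]
      simp only [hx]
      rw [Real.div_rpow (hT i) (hw0 i).le, e1]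
      field_simp
    -- The logarithm is at most `x ^ H / H = z ^ β / H`, and `1 / H ≤ (1 / H) ^ β` because `H ≤ 1 ≤
    -- β`.
    have hlog : ∀ i, 1 + x i ≤ Real.exp ((1 / H i * z i) ^ β) := fun i => by
      have hHi := (hH i).1
      rw [← Real.log_le_iff_le_exp (by linarith [hx0 i])]
      refine (Real.log_one_add_le_rpow_div (hx0 i) hHi (hH i).2).trans ?_
      rw [hxz i, Real.mul_rpow (by positivity) (hz0 i), div_eq_inv_mul, ← one_div]
      refine mul_le_mul_of_nonneg_right ?_ (Real.rpow_nonneg (hz0 i) _)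
      exact Real.self_le_rpow_of_one_le ((one_le_div hHi).2 (hH i).2) hβ
    push_cast
    calc ∏ i, ((s i).card : ℝ) ≤ ∏ i, Real.exp ((1 / H i * z i) ^ β) :=
          Finset.prod_le_prod (fun i _ => by positivity) fun i _ => (hs1 i).trans (hlog i)
      _ = Real.exp (∑ i, (1 / H i * z i) ^ β) := (Real.exp_sum _ _).symm
      -- Superadditivity of the `β`-th power pulls the sum over coordinates inside.
      _ ≤ Real.exp ((∑ i, 1 / H i * z i) ^ β) := by
          rw [Real.exp_le_exp, Fin.sum_univ_two, Fin.sum_univ_two]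
          exact Real.add_rpow_le_rpow_add
            (mul_nonneg (one_div_nonneg.2 (hH 0).1.le) (hz0 0))
            (mul_nonneg (one_div_nonneg.2 (hH 1).1.le) (hz0 1)) hβ
      _ = _ := by
          rw [Finset.mul_sum]
          congr 3 with i
          simp only [hz]; ring
  · intro t
    have hti : ∀ i, (t : Fin 2 → ℝ) i ∈ Set.Icc (a i) (b i) := fun i => ⟨t.2.1 i, t.2.2 i⟩
    choose y hy1 hy2 using fun i => hs3 i _ (hti i)
    have hyp : y ∈ Fintype.piFinset s := Fintype.mem_piFinset.2 hy1
    refine ⟨⟨y, hmem y hyp⟩, Finset.mem_subtype.2 hyp, ?_⟩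
    have : ∀ i, |(t : Fin 2 → ℝ) i - y i| ^ H i ≤ h / 2 := fun i => by
      have hHi := (hH i).1
      calc _ ≤ w i ^ H i := Real.rpow_le_rpow (abs_nonneg _) (hy2 i) hHi.le
        _ = h / 2 := by
          simp only [hw]
          rw [← Real.rpow_mul (by positivity), one_div_mul_cancel hHi.ne', Real.rpow_one]
    rw [anisoDist, Fin.sum_univ_two]
    linarith [this 0, this 1]

/-! ### Hölder's inequality and separability -/

/-- Hölder's inequality for finitely many functions with exponents summing to at most one. -/
theorem lintegral_prod_rpow_le_of_sum_le_one {Ω ι : Type*} [MeasurableSpace Ω] {P : Measure Ω}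
    [IsProbabilityMeasure P] (s : Finset ι) {f : ι → Ω → ENNReal} {p : ι → ℝ}
    (hf : ∀ i ∈ s, AEMeasurable (f i) P) (hp : ∀ i ∈ s, 0 ≤ p i) (hs : ∑ i ∈ s, p i ≤ 1) :
    ∫⁻ ω, ∏ i ∈ s, f i ω ^ p i ∂P ≤ ∏ i ∈ s, (∫⁻ ω, f i ω ∂P) ^ p i := by
  -- The missing weight `1 - ∑ p` goes to the constant function 1, whose integral is 1.
  have h := ENNReal.lintegral_mul_prod_norm_pow_le (μ := P) s (g := fun _ => 1) (f := f)
    aemeasurable_const hf (1 - ∑ i ∈ s, p i) (by ring) (by linarith) hp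
  simpa using h

/-- Because `G` does not depend on `t`, the bound says that `X t ω` lies in a single closed set.
Holding on a countable set off one null event, it extends to all `t` by separability. -/
theorem IsSeparableProcess.ae_exp_supAbs_le {Ω T : Type*} [MeasurableSpace Ω] {P : Measure Ω}
    {d : T → T → ℝ} {X : T → Ω → ℝ} (hsep : IsSeparableProcess P d X) {l : ℝ} (hl : 0 < l)
    {G : Ω → ENNReal} (hG : ∀ t, ∀ᵐ ω ∂P, ENNReal.ofReal (Real.exp (l * |X t ω|)) ≤ G ω) :
    ∀ᵐ ω ∂P, EReal.exp ((l : EReal) * supAbs X ω) ≤ G ω := by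
  obtain ⟨S, hS, -, hF⟩ := hsep
  have hall : ∀ᵐ ω ∂P, ∀ t ∈ S, ENNReal.ofReal (Real.exp (l * |X t ω|)) ≤ G ω :=
    (ae_ball_iff hS).2 fun t _ => hG t
  filter_upwards [hall, hF] with ω h1 h2
  have hcl : IsClosed {x : ℝ | ENNReal.ofReal (Real.exp (l * |x|)) ≤ G ω} :=
    isClosed_Iic.preimage (ENNReal.continuous_ofReal.comp
      (Real.continuous_exp.comp (continuous_const.mul continuous_abs)))
  have h3 := h2 Set.univ (fun _ _ => ⟨1, one_pos, fun _ _ => trivial⟩) _ hcl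
    (fun s hs => h1 s hs.1)
  have hl' : (0 : EReal) < (l : EReal) := by exact_mod_cast hl
  have h4 : (l : EReal) * supAbs X ω ≤ ENNReal.log (G ω) := by
    rw [mul_comm, ← EReal.le_div_iff_mul_le hl' (EReal.coe_ne_top l)]
    refine iSup_le fun t => ?_
    rw [EReal.le_div_iff_mul_le hl' (EReal.coe_ne_top l), mul_comm, ← EReal.coe_mul,
      ← EReal.exp_le_exp_iff, EReal.exp_coe, ENNReal.exp_log]
    exact h3 t trivial
  rw [← ENNReal.exp_log (G ω)]
  exact EReal.exp_monotone h4

/-! ### Chaining -/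

section Chaining

variable {Ω T : Type*} {X : T → Ω → ℝ}
  {π : ℕ → T → T} {S : ℕ → Finset T}

/-- The links of a chain of approximations: `X t` at level zero, `X t - X (π k t)` at level
`k + 1`. -/
def chainLink (X : T → Ω → ℝ) (π : ℕ → T → T) : ℕ → T → Ω → ℝ
  | 0, t => X t
  | k + 1, t => fun ω => X t ω - X (π k t) ω

/-- The exponential sum over all links at level `k` ending in the net `S k`. -/
noncomputable def chainSum (X : T → Ω → ℝ) (π : ℕ → T → T) (S : ℕ → Finset T) (l : ℝ)
    (p : ℕ → ℝ) (k : ℕ) (ω : Ω) : ENNReal :=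
  ∑ t ∈ S k, ENNReal.ofReal (Real.exp (l / p k * |chainLink X π k t ω|))

theorem ofReal_exp_le_chainSum_rpow {l : ℝ} {p : ℕ → ℝ} (hp : ∀ k, 0 < p k) {k : ℕ} {t : T}
    (ht : t ∈ S k) (ω : Ω) :
    ENNReal.ofReal (Real.exp (l * |chainLink X π k t ω|)) ≤ chainSum X π S l p k ω ^ p k := by
  have h1 : ENNReal.ofReal (Real.exp (l / p k * |chainLink X π k t ω|)) ≤
      chainSum X π S l p k ω :=
    Finset.single_le_sum (f := fun t => ENNReal.ofReal (Real.exp (l / p k *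
      |chainLink X π k t ω|))) (fun _ _ => bot_le) ht
  refine le_trans (le_of_eq ?_) (ENNReal.rpow_le_rpow h1 (hp k).le)
  rw [ENNReal.ofReal_rpow_of_pos (Real.exp_pos _), ← Real.exp_mul]
  congr 2
  have := (hp k).ne'
  field_simp

/-- Induction along the chain: the triangle inequality turns each link into one more factor, and the
right side no longer depends on `t`. -/
theorem ofReal_exp_le_prod_chainSum {l : ℝ} (hl : 0 ≤ l) {p : ℕ → ℝ} (hp : ∀ k, 0 < p k)
    (hπ : ∀ k t, π k t ∈ S k) (ω : Ω) :
    ∀ n, ∀ t ∈ S n, ENNReal.ofReal (Real.exp (l * |X t ω|)) ≤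
      ∏ k ∈ Finset.range (n + 1), chainSum X π S l p k ω ^ p k := by
  intro n
  induction n with
  | zero =>
    intro t ht
    rw [zero_add, Finset.prod_range_one]
    exact ofReal_exp_le_chainSum_rpow (X := X) (π := π) (l := l) hp ht ω
  | succ n ih =>
    intro t ht
    rw [Finset.prod_range_succ]
    have h1 := ih _ (hπ n t)
    have h2 := ofReal_exp_le_chainSum_rpow (X := X) (π := π) (l := l) hp ht ω
    refine le_trans ?_ (mul_le_mul' h1 h2)
    rw [← ENNReal.ofReal_mul (Real.exp_pos _).le, ← Real.exp_add, ← mul_add]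
    refine ENNReal.ofReal_le_ofReal (Real.exp_le_exp.2 (mul_le_mul_of_nonneg_left ?_ hl))
    have := abs_add_le (X (π n t) ω) (X t ω - X (π n t) ω)
    rwa [add_sub_cancel] at this

variable [MeasurableSpace Ω] {P : Measure Ω} {α : ℝ}

theorem isPhiSubGaussian_chainLink (hα : 0 < α) (hX : ∀ t, IsPhiSubGaussian P (powerPhi α) (X t)) :
    ∀ k t, IsPhiSubGaussian P (powerPhi α) (chainLink X π k t)
  | 0, t => hX t
  | _ + 1, t => (hX t).sub hα (hX _)

theorem tauPhi_chainLink_le {e : ℕ → ℝ} (h0 : ∀ t, tauPhi P (powerPhi α) (X t) ≤ e 0)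
    (h : ∀ k t, tauPhi P (powerPhi α) (fun ω => X t ω - X (π k t) ω) ≤ e (k + 1)) :
    ∀ k t, tauPhi P (powerPhi α) (chainLink X π k t) ≤ e k
  | 0, t => h0 t
  | k + 1, t => h k t

theorem aemeasurable_chainSum (hα : 0 < α) (hX : ∀ t, IsPhiSubGaussian P (powerPhi α) (X t))
    (l : ℝ) (p : ℕ → ℝ) (k : ℕ) : AEMeasurable (chainSum X π S l p k) P :=
  Finset.aemeasurable_fun_sum _ fun t _ => (Real.measurable_exp.comp_aemeasurable
    ((isPhiSubGaussian_chainLink hα hX k t).aemeasurable.abs.const_mul _)).ennreal_ofReal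

theorem lintegral_chainSum_le (hα : 0 < α) (hX : ∀ t, IsPhiSubGaussian P (powerPhi α) (X t))
    {l : ℝ} (hl : 0 ≤ l) {p : ℕ → ℝ} (hp : ∀ k, 0 < p k) {e : ℕ → ℝ}
    (he : ∀ k t, tauPhi P (powerPhi α) (chainLink X π k t) ≤ e k) (k : ℕ) :
    ∫⁻ ω, chainSum X π S l p k ω ∂P ≤
      ENNReal.ofReal ((S k).card * (2 * Real.exp ((l / p k * e k) ^ α / α))) := by
  unfold chainSum
  have hm : ∀ t ∈ S k, AEMeasurable
      (fun ω => ENNReal.ofReal (Real.exp (l / p k * |chainLink X π k t ω|))) P := fun t _ =>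
    (Real.measurable_exp.comp_aemeasurable
      ((isPhiSubGaussian_chainLink hα hX k t).aemeasurable.abs.const_mul _)).ennreal_ofReal
  rw [lintegral_finsetSum' _ hm]
  refine (Finset.sum_le_card_nsmul _ _ _ fun t _ =>
    (isPhiSubGaussian_chainLink hα hX k t).lintegral_exp_abs_le hα (he k t)
      (div_nonneg hl (hp k).le)).trans (le_of_eq ?_)
  rw [nsmul_eq_mul, ENNReal.ofReal_mul (Nat.cast_nonneg _), ENNReal.ofReal_natCast]

/-- The moment bound for chains through nets of metric entropy `d k ^ β` at scale `e k`, with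
weights adapted to `l`. -/
theorem lintegral_prod_chainSum_le [IsProbabilityMeasure P] {β : ℝ} (hαβ : α.HolderConjugate β)
    (hX : ∀ t, IsPhiSubGaussian P (powerPhi α) (X t)) {l : ℝ} (hl : 0 < l) {e d p : ℕ → ℝ}
    (he0 : ∀ k, 0 < e k) (he : ∀ k t, tauPhi P (powerPhi α) (chainLink X π k t) ≤ e k)
    (hd : ∀ k, 0 ≤ d k) (hS : ∀ k, ((S k).card : ℝ) ≤ Real.exp (d k ^ β)) {M : ℝ} (hM : 0 < M)
    {n : ℕ} (hsum : ∑ k ∈ Finset.range n, l * e k ≤ M)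
    (hp : ∀ k, p k = l * e k / (M ^ α + α * d k ^ β) ^ (1 / α)) :
    ∫⁻ ω, ∏ k ∈ Finset.range n, chainSum X π S l p k ω ^ p k ∂P ≤
      ENNReal.ofReal (2 * Real.exp (M ^ α / α + 2 * l * ∑ k ∈ Finset.range n, e k * d k)) := by
  have hα := hαβ.pos
  have hα1 := hαβ.lt
  set y : ℕ → ℝ := fun k => (M ^ α + α * d k ^ β) ^ (1 / α) with hy
  have hdβ : ∀ k, 0 ≤ d k ^ β := fun k => Real.rpow_nonneg (hd k) _
  have hbase : ∀ k, 0 < M ^ α + α * d k ^ β := fun k =>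
    add_pos_of_pos_of_nonneg (Real.rpow_pos_of_pos hM _) (mul_nonneg hα.le (hdβ k))
  have hy0 : ∀ k, 0 < y k := fun k => Real.rpow_pos_of_pos (hbase k) _
  have hyα : ∀ k, y k ^ α = M ^ α + α * d k ^ β := fun k => by
    simp only [hy]
    rw [← Real.rpow_mul (hbase k).le, one_div_mul_cancel hα.ne', Real.rpow_one]
  have hyM : ∀ k, M ≤ y k := fun k => by
    rw [← Real.rpow_le_rpow_iff hM.le (hy0 k).le hα, hyα]
    linarith [mul_nonneg hα.le (hdβ k)]
  -- By conjugacy `(β - 1) * α = β`, so `d ^ (β - 1) ≤ y` reduces to `d ^ β ≤ M ^ α + α * d ^ β`,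
  -- true as `α > 1`.
  have hyd : ∀ k, d k ^ β ≤ d k * y k := fun k => by
    rcases (hd k).eq_or_lt with h0 | h0
    · rw [← h0, Real.zero_rpow hαβ.symm.ne_zero, zero_mul]
    have h1 : d k ^ (β - 1) ≤ y k := by
      rw [← Real.rpow_le_rpow_iff (Real.rpow_nonneg h0.le _) (hy0 k).le hα, hyα,
        ← Real.rpow_mul h0.le, show (β - 1) * α = β by linarith [hαβ.mul_eq_add]]
      have := Real.rpow_pos_of_pos hM α
      nlinarith [hdβ k]
    calc d k ^ β = d k * d k ^ (β - 1) := by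
          rw [← Real.rpow_one_add' h0.le (by linarith [hαβ.symm.pos]), add_sub_cancel]
      _ ≤ d k * y k := by gcongr
  have hp' : ∀ k, p k = l * e k / y k := hp
  have hp0 : ∀ k, 0 < p k := fun k => by
    rw [hp']; exact div_pos (mul_pos hl (he0 k)) (hy0 k)
  have hpM : ∀ k, p k ≤ l * e k / M := fun k => by
    rw [hp']
    have := mul_pos hl (he0 k)
    gcongr
    exact hyM k
  have hp1 : ∑ k ∈ Finset.range n, p k ≤ 1 := by
    refine (Finset.sum_le_sum fun k _ => hpM k).trans ?_
    rw [← Finset.sum_div, div_le_one hM]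
    exact hsum
  have hpd : ∀ k, p k * d k ^ β ≤ l * (e k * d k) := fun k => by
    rw [hp', div_mul_eq_mul_div, div_le_iff₀ (hy0 k)]
    have := mul_le_mul_of_nonneg_left (hyd k) (mul_pos hl (he0 k)).le
    linarith
  have hterm : ∀ k, (∫⁻ ω, chainSum X π S l p k ω ∂P) ^ p k ≤ ENNReal.ofReal
      (Real.exp (p k * (Real.log 2 + M ^ α / α) + 2 * l * (e k * d k))) := fun k => by
    have h1 := lintegral_chainSum_le (S := S) hα hX hl.le hp0 he k
    have h2 : l / p k * e k = y k := by
      rw [hp']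
      have := (he0 k).ne'
      have := (hy0 k).ne'
      field_simp
    rw [h2, hyα] at h1
    -- One `d k ^ β` is the entropy of the net, the other comes from `y k ^ α / α`; hence the 2.
    have h3 : ((S k).card : ℝ) * (2 * Real.exp ((M ^ α + α * d k ^ β) / α)) ≤
        Real.exp (Real.log 2 + M ^ α / α + 2 * d k ^ β) := by
      calc _ ≤ Real.exp (d k ^ β) * (2 * Real.exp ((M ^ α + α * d k ^ β) / α)) := by
            gcongr; exact hS k
        _ = _ := by
            rw [add_div, mul_div_cancel_left₀ _ hα.ne', Real.exp_add, Real.exp_add, Real.exp_add,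
              Real.exp_log two_pos, two_mul (d k ^ β), Real.exp_add]
            ring
    have h4 := ENNReal.rpow_le_rpow (h1.trans (ENNReal.ofReal_le_ofReal h3)) (hp0 k).le
    refine h4.trans ?_
    rw [ENNReal.ofReal_rpow_of_pos (Real.exp_pos _), ← Real.exp_mul]
    refine ENNReal.ofReal_le_ofReal (Real.exp_le_exp.2 ?_)
    linarith [hpd k]
  calc _ ≤ ∏ k ∈ Finset.range n, (∫⁻ ω, chainSum X π S l p k ω ∂P) ^ p k :=
        lintegral_prod_rpow_le_of_sum_le_one _ (fun k _ => aemeasurable_chainSum hα hX l p k)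
          (fun k _ => (hp0 k).le) hp1
    _ ≤ ∏ k ∈ Finset.range n, ENNReal.ofReal
          (Real.exp (p k * (Real.log 2 + M ^ α / α) + 2 * l * (e k * d k))) :=
        Finset.prod_le_prod' fun k _ => hterm k
    _ = ENNReal.ofReal (Real.exp ((∑ k ∈ Finset.range n, p k) * (Real.log 2 + M ^ α / α) +
          2 * l * ∑ k ∈ Finset.range n, e k * d k)) := by
        rw [← ENNReal.ofReal_prod_of_nonneg fun k _ => (Real.exp_pos _).le, ← Real.exp_sum,
          Finset.sum_add_distrib, Finset.sum_mul, Finset.mul_sum]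
    _ ≤ _ := by
        refine ENNReal.ofReal_le_ofReal ?_
        refine le_of_le_of_eq ?_ (show Real.exp (Real.log 2 + (M ^ α / α +
          2 * l * ∑ k ∈ Finset.range n, e k * d k)) = _ by rw [Real.exp_add, Real.exp_log two_pos])
        refine Real.exp_le_exp.2 ?_
        have h5 : 0 ≤ Real.log 2 + M ^ α / α :=
          add_nonneg (Real.log_nonneg one_le_two) (div_nonneg (Real.rpow_nonneg hM.le _) hα.le)
        nlinarith

/-- First moments of the errors are summable, so the series of errors is almost surely finite and
its terms tend to zero. -/
theorem ae_tendsto_of_tauPhi_sub_le (hα : 0 < α)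
    (hX : ∀ t, IsPhiSubGaussian P (powerPhi α) (X t)) {e : ℕ → ℝ} (he0 : ∀ k, 0 < e k)
    (hes : Summable e) (t : T) {s : ℕ → T}
    (h : ∀ k, tauPhi P (powerPhi α) (fun ω => X t ω - X (s k) ω) ≤ e k) :
    ∀ᵐ ω ∂P, Tendsto (fun k => X (s k) ω) atTop (𝓝 (X t ω)) := by
  have hsub : ∀ k, IsPhiSubGaussian P (powerPhi α) (fun ω => X t ω - X (s k) ω) := fun k =>
    (hX t).sub hα (hX _)
  have hm : ∀ k, AEMeasurable (fun ω => ENNReal.ofReal |X t ω - X (s k) ω|) P := fun k =>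
    (hsub k).aemeasurable.abs.ennreal_ofReal
  have hfin : ∫⁻ ω, ∑' k, ENNReal.ofReal |X t ω - X (s k) ω| ∂P ≠ ⊤ := by
    rw [lintegral_tsum hm]
    refine ne_top_of_le_ne_top ?_ (ENNReal.tsum_le_tsum fun k =>
      (hsub k).lintegral_abs_le hα (h k) (he0 k))
    exact (hes.mul_right _).tsum_ofReal_ne_top
  filter_upwards [ae_lt_top' (AEMeasurable.tsum hm) hfin] with ω hω
  have h0 := ENNReal.tendsto_atTop_zero_of_tsum_ne_top hω.ne
  have h1 : Tendsto (fun k => |X t ω - X (s k) ω|) atTop (𝓝 0) := by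
    have := (ENNReal.tendsto_toReal ENNReal.zero_ne_top).comp h0
    simpa [Function.comp_def, ENNReal.toReal_ofReal] using this
  rw [← tendsto_sub_nhds_zero_iff, tendsto_zero_iff_abs_tendsto_zero]
  exact h1.congr fun k => abs_sub_comm _ _

/-- Chaining bound for the exponential moment of the supremum of a separable process. -/
theorem lintegral_exp_supAbs_le [IsProbabilityMeasure P] {β : ℝ} (hαβ : α.HolderConjugate β)
    (hX : ∀ t, IsPhiSubGaussian P (powerPhi α) (X t)) {δ : T → T → ℝ}
    (hsep : IsSeparableProcess P δ X) {l : ℝ} (hl : 0 < l) {e d : ℕ → ℝ}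
    (he0 : ∀ k, 0 < e k) (hes : Summable e) (h0 : ∀ t, tauPhi P (powerPhi α) (X t) ≤ e 0)
    (hS : ∀ k t, ∃ s ∈ S k, tauPhi P (powerPhi α) (fun ω => X t ω - X s ω) ≤ e (k + 1))
    (hd : ∀ k, 0 ≤ d k) (hcard : ∀ k, ((S k).card : ℝ) ≤ Real.exp (d k ^ β)) {M B : ℝ}
    (hM : 0 < M) (hsum : ∀ n, ∑ k ∈ Finset.range n, l * e k ≤ M)
    (hB : ∀ n, ∑ k ∈ Finset.range n, e k * d k ≤ B) :
    ∫⁻ ω, EReal.exp ((l : EReal) * supAbs X ω) ∂P ≤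
      ENNReal.ofReal (2 * Real.exp (M ^ α / α + 2 * l * B)) := by
  have hα := hαβ.pos
  choose π hπ hτ using hS
  set p : ℕ → ℝ := fun k => l * e k / (M ^ α + α * d k ^ β) ^ (1 / α) with hp
  have hp0 : ∀ k, 0 < p k := fun k =>
    div_pos (mul_pos hl (he0 k)) (Real.rpow_pos_of_pos (add_pos_of_pos_of_nonneg
      (Real.rpow_pos_of_pos hM _) (mul_nonneg hα.le (Real.rpow_nonneg (hd k) _))) _)
  set G : ℕ → Ω → ENNReal := fun n ω =>
    ∏ k ∈ Finset.range n, chainSum X π S l p k ω ^ p k with hG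
  have hGm : ∀ n, AEMeasurable (G n) P := fun n =>
    Finset.aemeasurable_fun_prod _ fun k _ => (aemeasurable_chainSum hα hX l p k).pow_const _
  by_cases hT : Nonempty T
  swap
  · rw [not_nonempty_iff] at hT
    have hz : ∀ ω, EReal.exp ((l : EReal) * supAbs X ω) = 0 := fun ω => by
      rw [supAbs, iSup_of_empty, EReal.coe_mul_bot_of_pos hl, EReal.exp_bot]
    simp [hz]
  obtain ⟨t₀⟩ := hT
  -- Every factor is at least 1, since each net is nonempty; this allows monotone convergence.
  have hmono : ∀ ω, Monotone fun n => G n ω := fun ω => by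
    refine monotone_nat_of_le_succ fun n => ?_
    simp only [hG]
    rw [Finset.prod_range_succ]
    refine le_mul_of_one_le_right' (le_trans ?_
      (ofReal_exp_le_chainSum_rpow hp0 (hπ n t₀) ω))
    rw [← ENNReal.ofReal_one]
    exact ENNReal.ofReal_le_ofReal (Real.one_le_exp (by positivity))
  have hbound : ∀ t, ∀ᵐ ω ∂P, ENNReal.ofReal (Real.exp (l * |X t ω|)) ≤ ⨆ n, G n ω := fun t => by
    filter_upwards [ae_tendsto_of_tauPhi_sub_le hα hX (fun k => he0 (k + 1))
      ((summable_nat_add_iff 1).2 hes) t (fun k => hτ k t)] with ω hω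
    have hc : Continuous fun x : ℝ => ENNReal.ofReal (Real.exp (l * |x|)) :=
      ENNReal.continuous_ofReal.comp
        (Real.continuous_exp.comp (continuous_const.mul continuous_abs))
    refine le_of_tendsto ((hc.tendsto _).comp hω) (Eventually.of_forall fun k => ?_)
    exact (ofReal_exp_le_prod_chainSum hl.le hp0 hπ ω k _ (hπ k t)).trans
      (le_iSup (fun n => G n ω) (k + 1))
  refine (lintegral_mono_ae (hsep.ae_exp_supAbs_le hl hbound)).trans ?_
  rw [lintegral_iSup' hGm (ae_of_all _ hmono)]
  refine iSup_le fun n => (lintegral_prod_chainSum_le hαβ hX hl he0 (tauPhi_chainLink_le h0 hτ)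
    hd hcard hM (hsum n) (fun _ => rfl)).trans (ENNReal.ofReal_le_ofReal ?_)
  have := hB n
  gcongr

end Chaining

/-! ### Nets for the increments and the entropy series -/

theorem tauPhi_zero_le {Ω : Type*} [MeasurableSpace Ω] (P : Measure Ω) [IsProbabilityMeasure P]
    {α : ℝ} (hα : 0 < α) {e : ℝ} (he : 0 < e) : tauPhi P (powerPhi α) (fun _ => 0) ≤ e := by
  refine csInf_le ⟨0, fun _ h => h.1.le⟩ ⟨he, fun l => ?_⟩
  have : 0 ≤ powerPhi α (e * l) := div_nonneg (Real.rpow_nonneg (abs_nonneg _) _) hα.le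
  simpa using this

/-- Nets with respect to the increments of the field, with a power bound for the entropy. -/
theorem exists_increment_net {Ω : Type*} [MeasurableSpace Ω] (P : Measure Ω)
    [IsProbabilityMeasure P] {α β : ℝ} (hα : 0 < α) (hβ : 1 ≤ β) {a b H : Fin 2 → ℝ}
    (hab : ∀ i, a i ≤ b i) (hH : ∀ i, 0 < H i ∧ H i ≤ 1) (X : Set.Icc a b → Ω → ℝ) {c γ : ℝ}
    (hc : 0 < c) (hγ : 0 < γ)
    (hincr : ∀ h : ℝ, 0 < h → h ≤ rectDiam a b H → ∀ t s : Set.Icc a b, anisoDist H t s ≤ h →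
      tauPhi P (powerPhi α) (fun ω => X t ω - X s ω) ≤ c * h ^ γ) {e : ℝ} (he : 0 < e) :
    ∃ S : Finset (Set.Icc a b),
      (S.card : ℝ) ≤ Real.exp (((2 : ℝ) ^ (1 / β) * c ^ (1 / (γ * β)) *
        (∑ i, 1 / H i * ((b i - a i) / 2) ^ (H i / β)) * e ^ (-(1 / (γ * β)))) ^ β) ∧
      ∀ t, ∃ s ∈ S, tauPhi P (powerPhi α) (fun ω => X t ω - X s ω) ≤ e := by
  have hsum0 : 0 ≤ ∑ i, 1 / H i * ((b i - a i) / 2) ^ (H i / β) :=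
    Finset.sum_nonneg fun i _ => mul_nonneg (one_div_nonneg.2 (hH i).1.le)
      (Real.rpow_nonneg (by linarith [hab i]) _)
  -- At scales above `c * diam ^ γ` one point suffices. A rectangle of zero diameter needs separate
  -- care, the increment hypothesis then being vacuous.
  rcases le_or_gt (c * rectDiam a b H ^ γ) e with hlarge | hsmall
  · refine ⟨{⟨a, le_rfl, hab⟩}, ?_, fun t => ⟨_, Finset.mem_singleton_self _, ?_⟩⟩
    · rw [Finset.card_singleton, Nat.cast_one]
      exact Real.one_le_exp (by positivity)
    · have hdist := anisoDist_le_rectDiam (fun i => (hH i).1) t ⟨a, le_rfl, hab⟩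
      rcases le_or_gt (rectDiam a b H) 0 with h0 | h0
      · have : t = ⟨a, le_rfl, hab⟩ :=
          Subtype.ext (eq_of_anisoDist_nonpos (fun i => (hH i).1) (hdist.trans h0))
        subst this
        simpa using tauPhi_zero_le P hα he
      · exact (hincr _ h0 le_rfl _ _ hdist).trans hlarge
  · have hγβ : 0 < γ * β := by positivity
    have hdiam : 0 ≤ rectDiam a b H :=
      (anisoDist_nonneg H a a).trans
        (anisoDist_le_rectDiam (fun i => (hH i).1) ⟨a, le_rfl, hab⟩ ⟨a, le_rfl, hab⟩)
    set h : ℝ := (e / c) ^ (1 / γ) with hh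
    have hh0 : 0 < h := by positivity
    have hhγ : c * h ^ γ = e := by
      rw [hh, ← Real.rpow_mul (by positivity), one_div_mul_cancel hγ.ne', Real.rpow_one]
      field_simp
    have hhd : h ≤ rectDiam a b H := by
      rw [← Real.rpow_le_rpow_iff hh0.le hdiam hγ]
      rw [← hhγ] at hsmall
      exact (lt_of_mul_lt_mul_left hsmall hc.le).le
    obtain ⟨S, hS1, hS2⟩ := exists_rect_net hab hH hβ hh0
    refine ⟨S, hS1.trans (le_of_eq ?_), fun t => ?_⟩
    · congr 2
      have : (2 / h) ^ (1 / β) = 2 ^ (1 / β) * c ^ (1 / (γ * β)) * e ^ (-(1 / (γ * β))) := by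
        rw [Real.div_rpow two_pos.le hh0.le, hh, ← Real.rpow_mul (by positivity),
          one_div_mul_one_div, Real.div_rpow he.le hc.le, Real.rpow_neg he.le]
        have := (Real.rpow_pos_of_pos he (1 / (γ * β))).ne'
        have := (Real.rpow_pos_of_pos hc (1 / (γ * β))).ne'
        field_simp
      rw [this]
      ring
    · obtain ⟨s, hs, hd⟩ := hS2 t
      exact ⟨s, hs, (hincr h hh0 hhd t s hd).trans hhγ.le⟩

/-- The entropy series along the geometric scale `ε θ ^ k` is bounded by the entropy integral. -/
theorem sum_geometric_entropy_le {ε θ A κ : ℝ} (hε : 0 < ε) (hθ : 0 < θ) (hθ1 : θ < 1)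
    (hA : 0 ≤ A) (hκ0 : 0 ≤ κ) (hκ1 : κ < 1) (n : ℕ) :
    ∑ k ∈ Finset.range n, ε * θ ^ k * (A * (ε * θ ^ (k + 1)) ^ (-κ)) ≤
      1 / (θ * (1 - θ)) * (θ * ε) ^ (1 - κ) * (A / (1 - κ)) := by
  set r : ℝ := θ ^ (1 - κ) with hr
  have hr0 : 0 < r := Real.rpow_pos_of_pos hθ _
  have hr1 : r < 1 := Real.rpow_lt_one hθ.le hθ1 (by linarith)
  -- Bernoulli's inequality for an exponent in `[0, 1]` produces the factor `1 / (1 - κ)` of `cOne`.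
  have hbern : (1 - κ) * (1 - θ) ≤ 1 - r := by
    have := rpow_one_add_le_one_add_mul_self (s := θ - 1) (by linarith) (p := 1 - κ)
      (by linarith) (by linarith)
    rw [add_sub_cancel] at this
    linarith
  have hterm : ∀ k, ε * θ ^ k * (A * (ε * θ ^ (k + 1)) ^ (-κ)) =
      A / θ * (θ * ε) ^ (1 - κ) * r ^ k := fun k => by
    have h1 : r ^ k = (θ ^ k) ^ (1 - κ) := by
      rw [hr, ← Real.rpow_natCast, ← Real.rpow_natCast, ← Real.rpow_mul hθ.le,
        ← Real.rpow_mul hθ.le, mul_comm]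
    have h2 : (θ * ε) ^ (1 - κ) * r ^ k = ε * θ ^ (k + 1) * (ε * θ ^ (k + 1)) ^ (-κ) := by
      rw [h1, ← Real.mul_rpow (by positivity) (by positivity),
        ← Real.rpow_one_add' (by positivity) (by linarith), ← sub_eq_add_neg]
      congr 1
      ring
    rw [mul_assoc (A / θ), h2, pow_succ]
    field_simp
  simp_rw [hterm]
  rw [← Finset.mul_sum]
  have hgeom : ∑ k ∈ Finset.range n, r ^ k ≤ 1 / ((1 - κ) * (1 - θ)) := by
    have h1 := geom_sum_Ico_le_of_lt_one (m := 0) (n := n) hr0.le hr1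
    rw [pow_zero, ← Finset.range_eq_Ico] at h1
    refine h1.trans (one_div_le_one_div_of_le (mul_pos ?_ ?_) hbern) <;> linarith
  have hpos : 0 ≤ A / θ * (θ * ε) ^ (1 - κ) := by positivity
  refine (mul_le_mul_of_nonneg_left hgeom hpos).trans (le_of_eq ?_)
  have : (1 - κ) ≠ 0 := by linarith
  have : (1 - θ) ≠ 0 := by linarith
  field_simp

/-! ### Measurability and the tail bound -/

theorem IsSeparableProcess.aemeasurable_supAbs {Ω T : Type*} [MeasurableSpace Ω] {P : Measure Ω}
    {d : T → T → ℝ} {X : T → Ω → ℝ} (hsep : IsSeparableProcess P d X)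
    (hX : ∀ t, AEMeasurable (X t) P) : AEMeasurable (supAbs X) P := by
  obtain ⟨S, hS, -, hF⟩ := hsep
  have hm : AEMeasurable (fun ω => ⨆ s ∈ S, ((|X s ω| : ℝ) : EReal)) P :=
    AEMeasurable.biSup S hS fun s _ => (hX s).abs.coe_real_ereal
  refine hm.congr ?_
  filter_upwards [hF] with ω hω
  refine le_antisymm (iSup₂_le fun s _ => le_iSup (fun t => ((|X t ω| : ℝ) : EReal)) s) ?_
  have hcl : IsClosed {x : ℝ | ((|x| : ℝ) : EReal) ≤ ⨆ s ∈ S, ((|X s ω| : ℝ) : EReal)} :=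
    isClosed_Iic.preimage (continuous_coe_real_ereal.comp continuous_abs)
  exact iSup_le fun t => hω Set.univ (fun _ _ => ⟨1, one_pos, fun _ _ => trivial⟩) _ hcl
    (fun s hs => le_iSup₂ (f := fun s (_ : s ∈ S) => ((|X s ω| : ℝ) : EReal)) s hs.1) t trivial

/-- The optimal Chernoff bound for an exponential moment of power type. -/
theorem measure_lt_le_of_lintegral_exp_le {Ω : Type*} [MeasurableSpace Ω] {P : Measure Ω}
    {Z : Ω → EReal} (hZ : AEMeasurable Z P) {α β : ℝ} (hαβ : α.HolderConjugate β) {K B u : ℝ}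
    (hK : 0 < K) (hu : B < u)
    (hmom : ∀ l : ℝ, 0 < l → ∫⁻ ω, EReal.exp ((l : EReal) * Z ω) ∂P ≤
      ENNReal.ofReal (2 * Real.exp (1 / α * (l * K) ^ α + l * B))) :
    P {ω | (u : EReal) < Z ω} ≤
      ENNReal.ofReal (2 * Real.exp (-(1 / β * ((u - B) / K) ^ β))) := by
  set w : ℝ := (u - B) / K with hw
  have hw0 : 0 < w := div_pos (sub_pos.2 hu) hK
  -- This `l` minimises `(l * K) ^ α / α - l * (u - B)`.
  set l : ℝ := w ^ (β - 1) / K with hl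
  have hl0 : 0 < l := div_pos (Real.rpow_pos_of_pos hw0 _) hK
  have hm : AEMeasurable (fun ω => EReal.exp ((l : EReal) * Z ω)) P :=
    EReal.measurable_exp.comp_aemeasurable (hZ.const_mul _)
  have hexp : 0 < Real.exp (l * u) := Real.exp_pos _
  calc P {ω | (u : EReal) < Z ω}
      ≤ P {ω | ENNReal.ofReal (Real.exp (l * u)) ≤ EReal.exp ((l : EReal) * Z ω)} := by
        refine measure_mono fun ω hω => ?_
        rw [Set.mem_ofPred_eq, ← EReal.exp_coe, EReal.exp_le_exp_iff, EReal.coe_mul]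
        exact mul_le_mul_of_nonneg_left (le_of_lt hω) (by exact_mod_cast hl0.le)
    _ ≤ (∫⁻ ω, EReal.exp ((l : EReal) * Z ω) ∂P) / ENNReal.ofReal (Real.exp (l * u)) :=
        meas_ge_le_lintegral_div hm (ENNReal.ofReal_pos.2 hexp).ne' ENNReal.ofReal_ne_top
    _ ≤ ENNReal.ofReal (2 * Real.exp (1 / α * (l * K) ^ α + l * B)) /
          ENNReal.ofReal (Real.exp (l * u)) := by gcongr; exact hmom l hl0
    _ = _ := by
        rw [← ENNReal.ofReal_div_of_pos hexp, mul_div_assoc, ← Real.exp_sub]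
        congr 3
        have h1 : l * K = w ^ (β - 1) := by rw [hl]; field_simp
        have h2 : (w ^ (β - 1)) ^ α = w ^ β := by
          rw [← Real.rpow_mul hw0.le, show (β - 1) * α = β by linarith [hαβ.mul_eq_add]]
        have h3 : l * (u - B) = w ^ β := by
          have : u - B = K * w := by rw [hw]; field_simp
          rw [this, ← mul_assoc, h1, ← Real.rpow_add_one hw0.ne', sub_add_cancel]
        have h4 : 1 / α = 1 - 1 / β := by
          have := hαβ.inv_add_inv_eq_one
          rw [one_div, one_div]
          linarith
        rw [h1, h2, h4]
        linarith

theorem cOne_nonneg {a b H : Fin 2 → ℝ} (hab : ∀ i, a i ≤ b i) (hH : ∀ i, 0 < H i)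
    {β γ c : ℝ} (hc : 0 ≤ c) (hγβ : 1 < γ * β) : 0 ≤ cOne a b H β γ c := by
  have h1 : 0 ≤ 1 - 1 / (γ * β) := by
    rw [sub_nonneg, div_le_one] <;> linarith
  refine mul_nonneg (by positivity) (Finset.sum_nonneg fun i _ => ?_)
  exact mul_nonneg (one_div_nonneg.2 (hH i).le) (Real.rpow_nonneg (by linarith [hab i]) _)

/-! ### Assembly -/

theorem lintegral_exp_supAbs_rect_le {Ω : Type*} [MeasurableSpace Ω] (P : Measure Ω)
    [IsProbabilityMeasure P] {α β : ℝ} (hαβ : α.HolderConjugate β)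
    {a b H : Fin 2 → ℝ} (hab : ∀ i, a i ≤ b i) (hH : ∀ i, 0 < H i ∧ H i ≤ 1)
    {X : Set.Icc a b → Ω → ℝ} (hX : ∀ t, IsPhiSubGaussian P (powerPhi α) (X t))
    {δ : Set.Icc a b → Set.Icc a b → ℝ} (hsep : IsSeparableProcess P δ X)
    {ε₀ : ℝ} (hε : ∀ t, tauPhi P (powerPhi α) (X t) ≤ ε₀)
    {c γ : ℝ} (hc : 0 < c) (hγ : 0 < γ) (hγβ : 1 < γ * β)
    (hincr : ∀ h : ℝ, 0 < h → h ≤ rectDiam a b H → ∀ t s : Set.Icc a b, anisoDist H t s ≤ h →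
      tauPhi P (powerPhi α) (fun ω => X t ω - X s ω) ≤ c * h ^ γ)
    {l θ : ℝ} (hl : 0 < l) (hθ : 0 < θ) (hθ1 : θ < 1) :
    ∫⁻ ω, EReal.exp ((l : EReal) * supAbs X ω) ∂P ≤
      ENNReal.ofReal (2 * Real.exp (1 / α * (l * ε₀ / (1 - θ)) ^ α +
        2 * l / (θ * (1 - θ)) * (θ * ε₀) ^ (1 - 1 / (γ * β)) * cOne a b H β γ c)) := by
  have hα := hαβ.pos
  have hθ' : 0 < 1 - θ := sub_pos.2 hθ1
  have hc1 := cOne_nonneg hab (fun i => (hH i).1) hc.le hγβ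
  have hε0 : 0 ≤ ε₀ := (tauPhi_nonneg _).trans (hε ⟨a, le_rfl, hab⟩)
  -- Chaining needs positive scales; for `ε₀ = 0` the field vanishes almost surely.
  rcases hε0.eq_or_lt with h0 | hεpos
  · subst h0
    have hz := hsep.ae_exp_supAbs_le hl (G := fun _ => 1) fun t => by
      filter_upwards [(hX t).ae_eq_zero hα (hε t)] with ω hω
      simp [hω]
    refine (lintegral_mono_ae hz).trans ?_
    rw [lintegral_const, measure_univ, mul_one, ← ENNReal.ofReal_one]
    refine ENNReal.ofReal_le_ofReal ?_
    have : 1 ≤ Real.exp (1 / α * (l * 0 / (1 - θ)) ^ α +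
        2 * l / (θ * (1 - θ)) * (θ * 0) ^ (1 - 1 / (γ * β)) * cOne a b H β γ c) := by
      refine Real.one_le_exp ?_
      rw [mul_zero, zero_div, mul_zero]
      positivity
    linarith
  set κ : ℝ := 1 / (γ * β) with hκ
  have hκ0 : 0 ≤ κ := by positivity
  have hκ1 : κ < 1 := by rw [hκ, div_lt_one] <;> linarith
  set A : ℝ := (2 : ℝ) ^ (1 / β) * c ^ κ * ∑ i, 1 / H i * ((b i - a i) / 2) ^ (H i / β) with hA
  have hA0 : 0 ≤ A := mul_nonneg (by positivity) (Finset.sum_nonneg fun i _ =>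
    mul_nonneg (one_div_nonneg.2 (hH i).1.le) (Real.rpow_nonneg (by linarith [hab i]) _))
  have hcA : cOne a b H β γ c = A / (1 - κ) := by
    rw [cOne, ← hκ, hA]; ring
  have he0 : ∀ k : ℕ, 0 < ε₀ * θ ^ k := fun k => by positivity
  -- The shift to `k + 1` is there because approximation by `S k` controls the links of level `k +
  -- 1`.
  choose S hS1 hS2 using fun k : ℕ =>
    exists_increment_net P hα hαβ.symm.lt.le hab hH X hc hγ hincr (he0 (k + 1))
  have hmain := lintegral_exp_supAbs_le (S := S) hαβ hX hsep hl he0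
    ((summable_geometric_of_lt_one hθ.le hθ1).mul_left ε₀) (by simpa using hε) hS2
    (d := fun k => A * (ε₀ * θ ^ (k + 1)) ^ (-κ))
    (fun k => mul_nonneg hA0 (Real.rpow_nonneg (he0 _).le _)) hS1
    (M := l * ε₀ / (1 - θ)) (by positivity) (fun n => by
      have h1 := geom_sum_Ico_le_of_lt_one (m := 0) (n := n) hθ.le hθ1
      rw [pow_zero, ← Finset.range_eq_Ico] at h1
      simp_rw [← mul_assoc]
      rw [← Finset.mul_sum, ← mul_one_div (l * ε₀)]
      gcongr)
    (fun n => sum_geometric_entropy_le hεpos hθ hθ1 hA0 hκ0 hκ1 n)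
  refine hmain.trans (le_of_eq ?_)
  rw [hcA]
  congr 3
  ring

theorem mainTheorem1 {Ω : Type*} [MeasurableSpace Ω] (P : Measure Ω) [IsProbabilityMeasure P]
    (α β : ℝ) (hα₁ : 1 < α) (hα₂ : α ≤ 2) (hβ : β = α / (α - 1))
    (a b H : Fin 2 → ℝ) (hab : ∀ i, a i ≤ b i) (hH : ∀ i, 0 < H i ∧ H i ≤ 1)
    (X : Set.Icc a b → Ω → ℝ)
    (hX : ∀ t, IsPhiSubGaussian P (powerPhi α) (X t))
    (hsep : IsSeparableProcess P (fun t s : Set.Icc a b => anisoDist H t s) X)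
    (ε₀ : ℝ) (hε₀ : IsLUB (Set.range fun t => tauPhi P (powerPhi α) (X t)) ε₀)
    (c γ : ℝ) (hc : 0 < c) (hγ₀ : 0 < γ) (hγ₁ : γ ≤ 1) (hγβ : 1 < γ * β)
    (hincr : ∀ h : ℝ, 0 < h → h ≤ rectDiam a b H → ∀ t s : Set.Icc a b, anisoDist H t s ≤ h →
      tauPhi P (powerPhi α) (fun ω => X t ω - X s ω) ≤ c * h ^ γ) :
    (∀ l θ : ℝ, 0 < l → 0 < θ → θ < 1 →
      ∫⁻ ω, EReal.exp ((l : EReal) * supAbs X ω) ∂P ≤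
        ENNReal.ofReal (2 * Real.exp (1 / α * (l * ε₀ / (1 - θ)) ^ α +
          2 * l / (θ * (1 - θ)) * (θ * ε₀) ^ (1 - 1 / (γ * β)) * cOne a b H β γ c))) ∧
    (∀ θ u : ℝ, 0 < θ → θ < 1 → θ * ε₀ < c * rectDiam a b H ^ γ →
      2 / (θ * (1 - θ)) * (θ * ε₀) ^ (1 - 1 / (γ * β)) * cOne a b H β γ c < u →
      P {ω | (u : EReal) < supAbs X ω} ≤
        ENNReal.ofReal (2 * Real.exp (-(1 / β * (1 / ε₀ * (u * (1 - θ) -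
          2 / θ * (θ * ε₀) ^ (1 - 1 / (γ * β)) * cOne a b H β γ c)) ^ β)))) := by
  have hα0 : 0 < α - 1 := sub_pos.2 hα₁
  have hαβ : α.HolderConjugate β := by
    rw [Real.holderConjugate_iff, hβ]
    refine ⟨hα₁, ?_⟩
    have : α ≠ 0 := by linarith
    field_simp
    ring
  have hε : ∀ t, tauPhi P (powerPhi α) (X t) ≤ ε₀ := fun t => hε₀.1 ⟨t, rfl⟩
  have hmom : ∀ l θ : ℝ, 0 < l → 0 < θ → θ < 1 →
      ∫⁻ ω, EReal.exp ((l : EReal) * supAbs X ω) ∂P ≤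
        ENNReal.ofReal (2 * Real.exp (1 / α * (l * ε₀ / (1 - θ)) ^ α +
          2 * l / (θ * (1 - θ)) * (θ * ε₀) ^ (1 - 1 / (γ * β)) * cOne a b H β γ c)) :=
    fun l θ hl hθ hθ1 =>
      lintegral_exp_supAbs_rect_le P hαβ hab hH hX hsep hε hc hγ₀ hγβ hincr hl hθ hθ1
  refine ⟨hmom, fun θ u hθ hθ1 _ hu => ?_⟩
  have hθ' : 0 < 1 - θ := sub_pos.2 hθ1
  have hε0 : 0 ≤ ε₀ := (tauPhi_nonneg _).trans (hε ⟨a, le_rfl, hab⟩)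
  rcases hε0.eq_or_lt with h0 | hεpos
  -- With `1 / 0 = 0` the right side equals 2, so the bound is trivial here.
  · refine prob_le_one.trans ?_
    rw [← h0, div_zero, zero_mul, Real.zero_rpow hαβ.symm.ne_zero, mul_zero, neg_zero,
      Real.exp_zero, mul_one, ← ENNReal.ofReal_one]
    exact ENNReal.ofReal_le_ofReal one_le_two
  refine (measure_lt_le_of_lintegral_exp_le
    (hsep.aemeasurable_supAbs fun t => (hX t).aemeasurable) hαβ
    (K := ε₀ / (1 - θ)) (div_pos hεpos hθ') hu fun l hl => ?_).trans (le_of_eq ?_)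
  · refine (hmom l θ hl hθ hθ1).trans (le_of_eq ?_)
    congr 3
    ring_nf
  · congr 6
    field_simp
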